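/- All rings are commutative with $1$. Let $A$ be an integral domain with field of fractions $K$. An overring of $A$ is a ring $B$ with $A\subseteq B\subseteq K$. A prime ideal $\mathfrak p$ of $A$ is called straight if for every overring $B$ of $A$ the $(A/\mathfrak p)$-module $B/\mathfrak pB$ is torsion-free, and $A$ is called a straight domain if all its prime ideals are straight. A property $\mathcal P$ of integral domains is called portable if, for every integral domain $T$, every maximal ideal $\mathfrak M$ of $T$ and every subring $D$ of the field $T/\mathfrak M$, the pullback $R=T\times_{T/\mathfrak M}D=\pi^{-1}(D)$, where $\pi\colon T\to T/\mathfrak M$ is the canonical map, has $\mathcal P$ if and only if both $T$ and $D$ have $\mathcal P$. (In particular this applies when $T$ is quasilocal with maximal ideal $\mathfrak M$.) Corollary. "Being a straight domain" is a portable property of integral domains: for all such $T$, $\mathfrak M$, $D$, the pullback $\pi^{-1}(D)$ is a straight domain if and only if both $T$ and $D$ are straight domains. -/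

import Mathlib

universe u

/-- A prime ideal `p` of `A` is straight if for every overring `B` of `A`, i.e. every ring between
`A` and its field of fractions, the `A ⧸ p`-module `B ⧸ pB` is torsion-free. -/
def IsStraightAt (A : Type u) [CommRing A] (p : Ideal A) : Prop :=
  ∀ B : Subalgebra A (FractionRing A),
    Module.IsTorsionFree (A ⧸ p) (B ⧸ (p • (⊤ : Submodule A B)))

/-- A straight domain is a domain all of whose prime ideals are straight. -/
def IsStraightDomain (A : Type u) [CommRing A] : Prop :=
  IsDomain A ∧ ∀ p : Ideal A, p.IsPrime → IsStraightAt A p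

/-- The pullback `T ×_{T/M} D` of the canonical surjection `T → T ⧸ M` along the inclusion of a
subring `D` of `T ⧸ M`, realized as the preimage of `D` in `T`. -/
def residuePullback {T : Type u} [CommRing T] (M : Ideal T) (D : Subring (T ⧸ M)) : Subring T :=
  D.comap (Ideal.Quotient.mk M)

/-- A property `P` of domains is portable if for every domain `T`, every maximal ideal `M` of `T`
and every subring `D` of the residue field `T ⧸ M`, the pullback `T ×_{T/M} D` has `P` if and only
if both `T` and `D` have `P`. (The case where `T` is quasilocal with maximal ideal `M` is
included.) -/
def IsPortable (P : (A : Type u) → [CommRing A] → Prop) : Prop :=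
  ∀ (T : Type u) [CommRing T] [IsDomain T] (M : Ideal T) [M.IsMaximal] (D : Subring (T ⧸ M)),
    P (residuePullback M D) ↔ P T ∧ P D

open Polynomial

/-! Straightness of `p` is equivalent to a condition that mentions no overring: each fraction `a /
s` with `a ∈ p`, `s ∉ p` enters `p` after multiplication by some `1 - r`, `r ∈ p`. Conversely this
condition lets `s` be cancelled in `B / pB`. For the forward direction only `B = A[x]`, `x = a / s`,
is needed: torsion-freeness gives `x ∈ pA[x]`, a polynomial relation whose degree is lowered to 1 by
a Nakayama argument.

The elementwise condition passes through the pullback: its primes containing `M` come from `D`, the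
others from `T`, and elements of `M` clear the difference between `T` and the pullback. -/

/-- A prime ideal `p` is locally divided if `p A_m = p A_p` for every maximal ideal `m ⊇ p`;
this is the equivalent elementwise condition. -/
def IsLocallyDividedAt {A : Type*} [CommRing A] (p : Ideal A) : Prop :=
  ∀ a ∈ p, ∀ s ∉ p, ∃ r ∈ p, ∃ c ∈ p, a * (1 - r) = s * c

/-! ### Straight primes are the locally divided primes -/

section Straight

variable {A : Type u} [CommRing A] {p : Ideal A}

theorem IsLocallyDividedAt.exists_smul_eq_smul {N : Type*} [AddCommGroup N] [Module A N]
    (h : IsLocallyDividedAt p) {s : A} (hs : s ∉ p) {z : N}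
    (hz : z ∈ p • (⊤ : Submodule A N)) :
    ∃ r ∈ p, ∃ w ∈ p • (⊤ : Submodule A N), (1 - r) • z = s • w := by
  induction hz using Submodule.smul_induction_on' with
  | smul a ha n hn =>
    obtain ⟨r, hr, c, hc, e⟩ := h a ha s hs
    refine ⟨r, hr, c • n, Submodule.smul_mem_smul hc hn, ?_⟩
    rw [smul_smul, smul_smul, ← e, mul_comm]
  | add x _ y _ hx hy =>
    obtain ⟨r, hr, w, hw, e⟩ := hx
    obtain ⟨r', hr', w', hw', e'⟩ := hy
    refine ⟨r + r' - r * r', sub_mem (add_mem hr hr') (p.mul_mem_right _ hr),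
      (1 - r') • w + (1 - r) • w',
      add_mem (Submodule.smul_mem _ _ hw) (Submodule.smul_mem _ _ hw'), ?_⟩
    have e1 : (1 - (r + r' - r * r')) = (1 - r') * (1 - r) := by ring
    have e2 : (1 - r') * (1 - r) = (1 - r) * (1 - r') := by ring
    rw [smul_add, smul_add, e1, mul_smul, e, e2, mul_smul, e', smul_comm _ s, smul_comm _ s]

theorem IsStraightAt.mem_smul_of_smul_mem [p.IsPrime] (h : IsStraightAt A p)
    (B : Subalgebra A (FractionRing A)) {s : A} (hs : s ∉ p) {z : FractionRing A} (hz : z ∈ B)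
    (hsz : s • z ∈ p • Subalgebra.toSubmodule B) : z ∈ p • Subalgebra.toSubmodule B := by
  have hmap : p • Subalgebra.toSubmodule B =
      (p • (⊤ : Submodule A B)).map B.val.toLinearMap := by
    rw [Submodule.map_smul'', Submodule.map_top]
    congr 1
    ext
    simp
  have key (b : B) : (b : FractionRing A) ∈ p • Subalgebra.toSubmodule B ↔
      b ∈ p • (⊤ : Submodule A B) := by
    rw [hmap]
    exact (Subtype.val_injective : Function.Injective B.val.toLinearMap).mem_set_image
  have hb := (key (s • ⟨z, hz⟩)).1 hsz
  refine (key ⟨z, hz⟩).2 ?_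
  have hreg : IsRegular (Ideal.Quotient.mk p s) :=
    IsRegular.of_ne_zero fun h0 => hs (Ideal.Quotient.eq_zero_iff_mem.1 h0)
  have hinj := (h B).isSMulRegular hreg
  rw [isSMulRegular_iff_right_eq_zero_of_smul] at hinj
  exact (Submodule.Quotient.mk_eq_zero _).1
    (hinj (Submodule.Quotient.mk ⟨z, hz⟩) ((Submodule.Quotient.mk_eq_zero _).2 hb))

theorem IsStraightAt.mem_smul_adjoin [p.IsPrime] (h : IsStraightAt A p) {s a : A} (hs : s ∉ p)
    (ha : a ∈ p) {x : FractionRing A} (hx : s • x = algebraMap A _ a) :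
    x ∈ p • Subalgebra.toSubmodule (Algebra.adjoin A {x}) := by
  refine h.mem_smul_of_smul_mem _ hs (Algebra.self_mem_adjoin_singleton A x) ?_
  rw [hx, Algebra.algebraMap_eq_smul_one]
  exact Submodule.smul_mem_smul ha (one_mem (Algebra.adjoin A {x}))

/-- Since `y ∈ pA[y]`, one has `A[y] = A + pA[y]`. As `A[y]` is finite over `A`, Nakayama gives `r ≡
1` mod `p` with `rA[y] ⊆ A`. -/
theorem IsStraightAt.exists_smul_eq_of_isIntegral [p.IsPrime] (h : IsStraightAt A p) {s a : A}
    (hs : s ∉ p) (ha : a ∈ p) {y : FractionRing A} (hy : s • y = algebraMap A _ a)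
    (hint : IsIntegral A y) : ∃ r, r - 1 ∈ p ∧ ∃ d ∈ p, r • y = algebraMap A _ d := by
  have hmem := h.mem_smul_adjoin hs ha hy
  have hle : Subalgebra.toSubmodule (Algebra.adjoin A {y}) ≤
      1 ⊔ p • Subalgebra.toSubmodule (Algebra.adjoin A {y}) := by
    intro z hz
    rw [Subalgebra.mem_toSubmodule, Algebra.adjoin_singleton_eq_range_aeval] at hz
    obtain ⟨f, rfl⟩ := hz
    rw [AlgHom.toRingHom_eq_coe, RingHom.coe_coe, ← f.divX_mul_X_add, map_add, map_mul, aeval_X,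
      aeval_C, add_comm, mul_comm]
    refine Submodule.add_mem_sup (Submodule.mem_one.2 ⟨_, rfl⟩) ?_
    have := Submodule.mul_mem_mul hmem
      ((Subalgebra.mem_toSubmodule _).2 (aeval_mem_adjoin_singleton (p := f.divX) A y))
    rwa [← smul_eq_mul, Submodule.smul_assoc, smul_eq_mul,
      (Subalgebra.isIdempotentElem_toSubmodule _).eq] at this
  obtain ⟨r, hr, hle'⟩ := Submodule.exists_sub_one_mem_and_smul_le_of_fg_of_le_sup
    hint.fg_adjoin_singleton le_rfl hle
  obtain ⟨d, hd⟩ := Submodule.mem_one.1 (hle' (Submodule.smul_mem_pointwise_smul y r _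
    (Algebra.self_mem_adjoin_singleton A y)))
  refine ⟨r, hr, d, ?_, hd.symm⟩
  have : s * d = r * a := by
    apply FaithfulSMul.algebraMap_injective A (FractionRing A)
    rw [map_mul, map_mul, hd, ← hy, Algebra.smul_def, Algebra.smul_def]
    ring
  exact (Ideal.IsPrime.mem_or_mem ‹_› (this ▸ p.mul_mem_left r ha)).resolve_left hs

/-- Degree descent: the leading coefficient times `x` is integral, so by Nakayama a multiple by some
`r ≡ 1` mod `p` is some `d ∈ p`, and the top term becomes `d * x ^ (n + 1)`. -/
theorem IsStraightAt.exists_smul_eq_of_aeval [p.IsPrime] (h : IsStraightAt A p) {s a : A}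
    (hs : s ∉ p) (ha : a ∈ p) {x : FractionRing A} (hx : s • x = algebraMap A _ a) (n : ℕ) :
    ∀ (e : A) (g : A[X]), e - 1 ∈ p → (∀ i, g.coeff i ∈ p) → g.natDegree ≤ n + 1 →
      e • x = aeval x g → ∃ r, r - 1 ∈ p ∧ ∃ c ∈ p, r • x = algebraMap A _ c := by
  induction n with
  | zero =>
    intro e g he hg hn hxg
    -- A linear relation is solved by moving its `x` term to the left.
    refine ⟨e - g.coeff 1, ?_, g.coeff 0, hg 0, ?_⟩
    · rw [sub_right_comm]
      exact sub_mem he (hg 1)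
    · rw [eq_X_add_C_of_natDegree_le_one hn] at hxg
      simp only [map_add, map_mul, aeval_C, aeval_X] at hxg
      rw [sub_smul, hxg, Algebra.smul_def]
      ring
  | succ n ih =>
    intro e g he hg hn hxg
    have hdec : g = g.erase (n + 2) + monomial (n + 2) (g.coeff (n + 2)) :=
      (add_comm _ _).trans (monomial_add_erase g (n + 2)) |>.symm
    have hint : IsIntegral A (g.coeff (n + 2) • x) := by
      by_cases h0 : g.coeff (n + 2) = 0
      · rw [h0, zero_smul]
        exact isIntegral_zero
      have hdeg : g.natDegree = n + 2 := le_antisymm hn (le_natDegree_of_ne_zero h0)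
      -- Degree at least 2 keeps `e * X` away from the leading term.
      have hlt : (C e * X).degree < g.degree := by
        refine (degree_C_mul_X_le e).trans_lt ?_
        rw [degree_eq_natDegree (fun hg0 => h0 (by rw [hg0, coeff_zero])), hdeg]
        exact_mod_cast (by omega : 1 < n + 2)
      have hlead : (g - C e * X).leadingCoeff = g.coeff (n + 2) := by
        rw [leadingCoeff_sub_of_degree_lt hlt, leadingCoeff, hdeg]
      rw [← hlead]
      refine isIntegral_leadingCoeff_smul _ x ?_
      rw [map_sub, ← hxg, map_mul, aeval_C, aeval_X, ← Algebra.smul_def, sub_self]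
    obtain ⟨r, hr, d, hd, hrd⟩ := h.exists_smul_eq_of_isIntegral hs
      (p.mul_mem_left (g.coeff (n + 2)) ha)
      (by rw [smul_comm, hx, map_mul, Algebra.smul_def]) hint
    refine ih (r * e) (C r * g.erase (n + 2) + monomial (n + 1) d) ?_ (fun i => ?_) ?_ ?_
    · have : r * e - 1 = r * (e - 1) + (r - 1) := by ring
      rw [this]
      exact add_mem (p.mul_mem_left _ he) hr
    · rw [coeff_add, coeff_C_mul, coeff_erase, coeff_monomial]
      refine add_mem (p.mul_mem_left _ ?_) ?_ <;> split_ifs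
      exacts [p.zero_mem, hg i, hd, p.zero_mem]
    · refine natDegree_add_le_of_degree_le ((natDegree_C_mul_le _ _).trans ?_)
        (natDegree_monomial_le _)
      refine natDegree_le_iff_coeff_eq_zero.2 fun i hi => ?_
      rw [coeff_erase]
      split_ifs with hi'
      · rfl
      · exact coeff_eq_zero_of_natDegree_lt (by omega)
    · rw [hdec, map_add, aeval_monomial] at hxg
      rw [mul_smul, hxg, map_add, map_mul, aeval_C, aeval_monomial, ← hrd]
      simp only [Algebra.smul_def]
      ring

variable [IsDomain A]

theorem IsLocallyDividedAt.isStraightAt [p.IsPrime] (h : IsLocallyDividedAt p) :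
    IsStraightAt A p := by
  intro B
  refine ⟨fun r hr => ?_⟩
  obtain ⟨s, rfl⟩ := Ideal.Quotient.mk_surjective r
  have hs : s ∉ p := fun hs => hr.ne_zero (Ideal.Quotient.eq_zero_iff_mem.2 hs)
  have hs0 : s ≠ 0 := fun h0 => hs (h0 ▸ p.zero_mem)
  rw [isSMulRegular_iff_right_eq_zero_of_smul]
  intro b hb
  obtain ⟨b, rfl⟩ := Submodule.Quotient.mk_surjective _ b
  have hb' : s • b ∈ p • (⊤ : Submodule A B) := (Submodule.Quotient.mk_eq_zero _).1 hb
  obtain ⟨r, hr, w, hw, e⟩ := h.exists_smul_eq_smul hs hb'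
  rw [smul_comm] at e
  have e' : (1 - r) • b = w := smul_right_injective B hs0 e
  rw [Submodule.Quotient.mk_eq_zero]
  have : b = w + r • b := by rw [← e', sub_smul, one_smul, sub_add_cancel]
  rw [this]
  exact add_mem hw (Submodule.smul_mem_smul hr trivial)

theorem IsStraightAt.isLocallyDividedAt [p.IsPrime] (h : IsStraightAt A p) :
    IsLocallyDividedAt p := by
  intro a ha s hs
  have hs0 : algebraMap A (FractionRing A) s ≠ 0 := by
    rw [Ne, FaithfulSMul.algebraMap_eq_zero_iff]
    exact fun h0 => hs (h0 ▸ p.zero_mem)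
  set x : FractionRing A := algebraMap A _ a / algebraMap A _ s with hxdef
  have hx : s • x = algebraMap A _ a := by
    rw [Algebra.smul_def, mul_div_cancel₀ _ hs0]
  obtain ⟨g, hg, hxg⟩ : ∃ g : A[X], (∀ i, g.coeff i ∈ p) ∧ x = aeval x g := by
    refine Submodule.smul_induction_on (p := fun z => ∃ g : A[X], (∀ i, g.coeff i ∈ p) ∧
      z = aeval x g) (h.mem_smul_adjoin hs ha hx) (fun b hb z hz => ?_) ?_
    · rw [Subalgebra.mem_toSubmodule, Algebra.adjoin_singleton_eq_range_aeval] at hz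
      obtain ⟨f, rfl⟩ := hz
      refine ⟨b • f, fun i => ?_, (map_smul (aeval x) b f).symm⟩
      rw [coeff_smul, smul_eq_mul]
      exact p.mul_mem_right _ hb
    · rintro _ _ ⟨f, hf, rfl⟩ ⟨g, hg, rfl⟩
      refine ⟨f + g, fun i => ?_, (map_add _ _ _).symm⟩
      rw [coeff_add]
      exact add_mem (hf i) (hg i)
  obtain ⟨r, hr, c, hc, e⟩ := h.exists_smul_eq_of_aeval hs ha hx g.natDegree 1 g (by simp) hg
    (Nat.le_succ _) (by rw [one_smul, ← hxg])
  refine ⟨1 - r, by rw [← neg_sub]; exact neg_mem hr, c, hc, ?_⟩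
  apply FaithfulSMul.algebraMap_injective A (FractionRing A)
  rw [map_mul, map_mul, sub_sub_cancel, ← hx, ← e, Algebra.smul_def, Algebra.smul_def]
  ring

theorem isStraightAt_iff_isLocallyDividedAt [p.IsPrime] :
    IsStraightAt A p ↔ IsLocallyDividedAt p :=
  ⟨IsStraightAt.isLocallyDividedAt, IsLocallyDividedAt.isStraightAt⟩

end Straight

/-- A domain is straight if and only if all of its primes are locally divided. -/
theorem isStraightDomain_iff {A : Type u} [CommRing A] [IsDomain A] :
    IsStraightDomain A ↔ ∀ p : Ideal A, p.IsPrime → IsLocallyDividedAt p := by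
  rw [IsStraightDomain, and_iff_right ‹_›]
  exact forall₂_congr fun p _ => isStraightAt_iff_isLocallyDividedAt

/-! ### Local dividedness and primes in the pullback -/

section Pullback

variable {T : Type u} [CommRing T] {M : Ideal T} {D : Subring (T ⧸ M)}

theorem mem_residuePullback_of_mem {m : T} (hm : m ∈ M) : m ∈ residuePullback M D := by
  rw [residuePullback, Subring.mem_comap, Ideal.Quotient.eq_zero_iff_mem.2 hm]
  exact D.zero_mem

/-- The surjection of the pullback onto `D`. -/
def residuePullbackMap (M : Ideal T) (D : Subring (T ⧸ M)) : residuePullback M D →+* D :=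
  ((Ideal.Quotient.mk M).comp (residuePullback M D).subtype).codRestrict D fun x => x.2

theorem residuePullbackMap_surjective : Function.Surjective (residuePullbackMap M D) := by
  rintro ⟨d, hd⟩
  obtain ⟨t, rfl⟩ := Ideal.Quotient.mk_surjective d
  exact ⟨⟨t, hd⟩, rfl⟩

theorem residuePullbackMap_eq_zero_iff {x : residuePullback M D} :
    residuePullbackMap M D x = 0 ↔ (x : T) ∈ M := by
  rw [← Ideal.Quotient.eq_zero_iff_mem, Subtype.ext_iff]
  rfl

theorem Ideal.IsMaximal.exists_mul_eq_one_sub (hM : M.IsMaximal) {s : T} (hs : s ∉ M) :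
    ∃ t, ∃ m ∈ M, s * t = 1 - m := by
  obtain ⟨t, m, hm, h⟩ := hM.exists_inv hs
  exact ⟨t, m, hm, by rw [← h]; ring⟩

theorem IsLocallyDividedAt.of_isMaximal (hM : M.IsMaximal) : IsLocallyDividedAt M := by
  intro a ha s hs
  obtain ⟨t, m, hm, h⟩ := hM.exists_mul_eq_one_sub hs
  exact ⟨m, hm, a * t, M.mul_mem_right _ ha, by rw [← h]; ring⟩

theorem IsLocallyDividedAt.of_comap_surjective {A B : Type*} [CommRing A] [CommRing B]
    {f : A →+* B} (hf : Function.Surjective f) {q : Ideal B}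
    (h : IsLocallyDividedAt (q.comap f)) : IsLocallyDividedAt q := by
  intro a ha s hs
  obtain ⟨a, rfl⟩ := hf a
  obtain ⟨s, rfl⟩ := hf s
  obtain ⟨r, hr, c, hc, e⟩ := h a ha s hs
  exact ⟨f r, hr, f c, hc, by simpa using congrArg f e⟩

/-- Scaling `a` and `s` by some `m ∈ M` outside `Q` puts both in the pullback; `m` then cancels. -/
theorem IsLocallyDividedAt.of_comap_residuePullback [IsDomain T] {Q : Ideal T} (hQ : Q.IsPrime)
    (hMQ : ¬M ≤ Q) (h : IsLocallyDividedAt (Q.comap (residuePullback M D).subtype)) :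
    IsLocallyDividedAt Q := by
  intro a ha s hs
  obtain ⟨m, hm, hmQ⟩ := SetLike.not_le_iff_exists.1 hMQ
  obtain ⟨r, hr, c, hc, e⟩ := h
    ⟨m * a, mem_residuePullback_of_mem (M.mul_mem_right _ hm)⟩ (Q.mul_mem_left _ ha)
    ⟨m * s, mem_residuePullback_of_mem (M.mul_mem_right _ hm)⟩
    (fun h' => (hQ.mem_or_mem h').elim hmQ hs)
  refine ⟨r, hr, c, hc, ?_⟩
  have e' : m * a * (1 - r) = m * s * c := congrArg Subtype.val e
  refine mul_left_cancel₀ (fun h0 : m = 0 => hmQ (h0 ▸ Q.zero_mem)) ?_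
  rw [← mul_assoc, e', mul_assoc]

/-- The pullback is locally divided at the primes that come from `D`. -/
theorem IsLocallyDividedAt.comap_residuePullbackMap (hM : M.IsMaximal) {q : Ideal D}
    (h : IsLocallyDividedAt q) : IsLocallyDividedAt (q.comap (residuePullbackMap M D)) := by
  have hMp (m : residuePullback M D) (hm : (m : T) ∈ M) : m ∈ q.comap (residuePullbackMap M D) := by
    rw [Ideal.mem_comap, residuePullbackMap_eq_zero_iff.2 hm]
    exact q.zero_mem
  intro a ha s hs
  obtain ⟨r', hr, c', hc, e⟩ := h _ ha _ hs
  obtain ⟨r, rfl⟩ := residuePullbackMap_surjective r'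
  obtain ⟨c, rfl⟩ := residuePullbackMap_surjective c'
  have hm : ((a * (1 - r) - s * c : residuePullback M D) : T) ∈ M := by
    rw [← residuePullbackMap_eq_zero_iff, map_sub, map_mul, map_mul, map_sub, map_one, e, sub_self]
  -- The lifted equation fails by an error in `M`. Multiplying by `1 - n = s * t` makes that error
  -- divisible by `s`.
  obtain ⟨t, n, hn, hst⟩ := hM.exists_mul_eq_one_sub fun hsM => hs (hMp s hsM)
  have htm := M.mul_mem_left t hm
  let n' : residuePullback M D := ⟨n, mem_residuePullback_of_mem hn⟩
  let m' : residuePullback M D := ⟨_, mem_residuePullback_of_mem htm⟩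
  refine ⟨r + n' - r * n', sub_mem (add_mem hr (hMp n' hn)) (Ideal.mul_mem_right _ _ hr),
    c * (1 - n') + m', add_mem (Ideal.mul_mem_right _ _ hc) (hMp m' htm), Subtype.ext ?_⟩
  simp only [n', m', Subring.coe_mul, Subring.coe_add, AddSubgroupClass.coe_sub,
    Subring.coe_one]
  linear_combination (-(a : T) * (1 - r) + s * c) * hst

/-- The pullback is locally divided at the primes that come from `T`. -/
theorem IsLocallyDividedAt.comap_residuePullback (hM : M.IsMaximal) {Q : Ideal T}
    (h : IsLocallyDividedAt Q) : IsLocallyDividedAt (Q.comap (residuePullback M D).subtype) := by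
  intro a ha s hs
  obtain ⟨r, hr, c, hc, e⟩ := h a ha s hs
  by_cases hQM : Q ≤ M
  · exact ⟨⟨r, mem_residuePullback_of_mem (hQM hr)⟩, hr,
      ⟨c, mem_residuePullback_of_mem (hQM hc)⟩, hc, Subtype.ext e⟩
  obtain ⟨q, hq, hqM⟩ := SetLike.not_le_iff_exists.1 hQM
  obtain ⟨t, m, hm, hqt⟩ := hM.exists_mul_eq_one_sub hqM
  have hmQ : 1 - m ∈ Q := hqt ▸ Q.mul_mem_right _ hq
  let m' : residuePullback M D := ⟨m, mem_residuePullback_of_mem hm⟩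
  -- Chosen so that one minus this witness is `m * (1 - r)`.
  refine ⟨1 - m' + ⟨m * r, mem_residuePullback_of_mem (M.mul_mem_right _ hm)⟩,
    add_mem (s := Q.comap (residuePullback M D).subtype) hmQ (Q.mul_mem_left _ hr),
    ⟨m * c, mem_residuePullback_of_mem (M.mul_mem_right _ hm)⟩, Q.mul_mem_left _ hc,
    Subtype.ext ?_⟩
  simp only [m', Subring.coe_mul, Subring.coe_add, AddSubgroupClass.coe_sub,
    Subring.coe_one]
  linear_combination m * e

/-- A prime of the pullback comes from `D` if it contains `M`. -/
theorem exists_comap_residuePullbackMap_eq {p : Ideal (residuePullback M D)} (hp : p.IsPrime)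
    (hMp : ∀ x : residuePullback M D, (x : T) ∈ M → x ∈ p) :
    ∃ q : Ideal D, q.IsPrime ∧ q.comap (residuePullbackMap M D) = p := by
  have hker : RingHom.ker (residuePullbackMap M D) ≤ p := fun x hx =>
    hMp x (residuePullbackMap_eq_zero_iff.1 hx)
  refine ⟨p.map (residuePullbackMap M D),
    Ideal.map_isPrime_of_surjective residuePullbackMap_surjective hker, ?_⟩
  rw [Ideal.comap_map_of_surjective' _ residuePullbackMap_surjective, sup_eq_left.2 hker]

/-- A prime of the pullback comes from `T` if it does not contain `M`. -/
theorem exists_comap_subtype_eq {p : Ideal (residuePullback M D)} (hp : p.IsPrime)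
    {m : residuePullback M D} (hm : (m : T) ∈ M) (hmp : m ∉ p) :
    ∃ Q : Ideal T, Q.IsPrime ∧ Q.comap (residuePullback M D).subtype = p := by
  let k (t : T) : residuePullback M D := ⟨m * t, mem_residuePullback_of_mem (M.mul_mem_right t hm)⟩
  -- The pullback and `T` agree after inverting `m`, so `Q` is the only candidate.
  let Q : Ideal T :=
    { carrier := {t | k t ∈ p}
      zero_mem' := by
        have : k 0 = 0 := Subtype.ext (mul_zero _)
        simp only [Set.mem_ofPred_eq, this, p.zero_mem]
      add_mem' := fun {x y} hx hy => by
        have : k (x + y) = k x + k y := Subtype.ext (mul_add _ _ _)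
        simpa only [Set.mem_ofPred_eq, this] using add_mem hx hy
      smul_mem' := fun c x hx => by
        refine (hp.mem_or_mem (x := m) ?_).resolve_left hmp
        have : m * k (c • x) = k c * k x := Subtype.ext <| by
          simp only [k, Subring.coe_mul, smul_eq_mul]
          ring
        exact this ▸ p.mul_mem_left _ hx }
  have hQ (t : T) : t ∈ Q ↔ k t ∈ p := Iff.rfl
  refine ⟨Q, ⟨?_, fun {x y} hxy => ?_⟩, ?_⟩
  · rw [Ne, Ideal.eq_top_iff_one, hQ]
    have : k 1 = m := Subtype.ext (mul_one _)
    rwa [this]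
  · rw [hQ] at hxy ⊢
    rw [hQ]
    refine hp.mem_or_mem ?_
    have : k x * k y = m * k (x * y) := Subtype.ext <| by
      simp only [k, Subring.coe_mul]
      ring
    exact this ▸ p.mul_mem_left _ hxy
  · ext x
    have : k x = m * x := rfl
    rw [Ideal.mem_comap, Subring.subtype_apply, hQ, this]
    exact ⟨fun h => (hp.mem_or_mem h).resolve_left hmp, p.mul_mem_left _⟩

end Pullback

/-- Being a straight domain is a portable property of domains. -/
theorem mainTheorem4 : IsPortable.{u} (fun A _ => IsStraightDomain A) := by
  intro T _ _ M hM D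
  simp only [isStraightDomain_iff]
  refine ⟨fun h => ⟨fun Q hQ => ?_, fun q hq => ?_⟩, fun ⟨hT, hD⟩ p hp => ?_⟩
  -- `M` itself needs no hypothesis: maximal ideals are always locally divided.
  · by_cases hMQ : M ≤ Q
    · obtain rfl := hM.eq_of_le hQ.ne_top hMQ
      exact .of_isMaximal hM
    · exact .of_comap_residuePullback hQ hMQ (h _ inferInstance)
  · exact .of_comap_surjective residuePullbackMap_surjective (h _ inferInstance)
  · by_cases hMp : ∀ x : residuePullback M D, (x : T) ∈ M → x ∈ p
    · obtain ⟨q, hq, rfl⟩ := exists_comap_residuePullbackMap_eq hp hMp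
      exact (hD q hq).comap_residuePullbackMap hM
    · push Not at hMp
      obtain ⟨m, hm, hmp⟩ := hMp
      obtain ⟨Q, hQ, rfl⟩ := exists_comap_subtype_eq hp hm hmp
      exact (hT Q hQ).comap_residuePullback hM
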